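/- Let $A$ be a unital $\mathrm{C}^*$-algebra and let $D\subset A$ be a sub-$\mathrm{C}^*$-algebra containing $1_A$. Write $\mathcal N_A(D)=\{v\in A: vDv^*\cup v^*Dv\subset D\}$ for the set of normalisers. Call $(D\subset A)$ a \emph{diagonal pair} if $D$ is a maximal abelian $^*$-subalgebra (masa) of $A$, $\mathcal N_A(D)$ generates $A$ as a $\mathrm{C}^*$-algebra, there is a faithful conditional expectation $\Phi\colon A\to D$ (it is then unique, and is called the associated conditional expectation), and every pure state on $D$ extends uniquely to a pure state on $A$. For $d\in\mathbb N=\{0,1,2,\dots\}$ write $\dim_{\mathrm{diag}}(D\subset A)\le d$ if for every finite set $S\subset A$ and every $\varepsilon>0$ there are a finite-dimensional $\mathrm{C}^*$-algebra $F=\bigoplus_{j=0}^dF^{(j)}$ with a masa $D_F=\bigoplus_{j=0}^dD_{F^{(j)}}$ and completely positive maps $\psi\colon A\to F$ and $\varphi\colon F\to A$ such that $\psi$ is contractive, $\|\varphi\psi(a)-a\|<\varepsilon$ for all $a\in S$, $\psi(D)\subset D_F$, and, for each $j=0,\dots,d$, the restriction $\varphi^{(j)}=\varphi|_{F^{(j)}}$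 is contractive and of order zero (i.e. $\varphi^{(j)}(x)\varphi^{(j)}(y)=0$ whenever $x,y\in F^{(j)}_+$ and $xy=0$) and satisfies $\varphi^{(j)}(\mathcal N_{F^{(j)}}(D_{F^{(j)}}))\subset\mathcal N_A(D)$. The diagonal dimension $\dim_{\mathrm{diag}}(D\subset A)\in\mathbb N\cup\{\infty\}$ is the least such $d$, and $\infty$ if there is none. \textbf{Proposition.} Let $(D\subset A)$ be a unital diagonal pair with associated conditional expectation $\Phi\colon A\to D$. If $\dim_{\mathrm{diag}}(D\subset A)<\infty$, then $\Phi$ is hereditary: for every $a\in A_+$, the element $a$ lies in $\mathrm{her}(\Phi(a))$, the hereditary sub-$\mathrm{C}^*$-algebra of $A$ generated by $\Phi(a)$. -/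

import Mathlib

namespace DiagonalPair

open scoped ComplexOrder CStarAlgebra

/-- `D` is a maximal abelian ⋆-subalgebra (masa) of the unital ⋆-algebra `A`. Every ⋆-subalgebra
containing `D` contains `1`, so it is enough to compare with unital ⋆-subalgebras. -/
def IsMasa {A : Type*} [Ring A] [StarRing A] [Algebra ℂ A] [StarModule ℂ A]
    (D : StarSubalgebra ℂ A) : Prop :=
  Maximal (fun S : StarSubalgebra ℂ A => ∀ x ∈ S, ∀ y ∈ S, x * y = y * x) D

/-- The set of normalisers `{v ∈ A : v D v⋆ ∪ v⋆ D v ⊆ D}`. -/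
def normalisers {A : Type*} [Ring A] [StarRing A] [Algebra ℂ A] [StarModule ℂ A]
    (D : StarSubalgebra ℂ A) : Set A :=
  {v | ∀ x ∈ D, v * x * star v ∈ D ∧ star v * x * v ∈ D}

/-- The states on a unital C⋆-algebra: the positive linear functionals `ω` with `ω 1 = 1`. -/
def states (B : Type*) [Ring B] [StarRing B] [Algebra ℂ B] : Set (B →ₗ[ℂ] ℂ) :=
  {ω | (∀ b : B, 0 ≤ ω (star b * b)) ∧ ω 1 = 1}

/-- The pure states: the extreme points of the convex set of states. -/
def pureStates (B : Type*) [Ring B] [StarRing B] [Algebra ℂ B] : Set (B →ₗ[ℂ] ℂ) :=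
  Set.extremePoints ℝ (states B)

/-- Every pure state on `D` extends uniquely to a pure state on `A`. -/
def UniqueExtensionProperty {A : Type*} [Ring A] [StarRing A] [Algebra ℂ A] [StarModule ℂ A]
    (D : StarSubalgebra ℂ A) : Prop :=
  ∀ θ ∈ pureStates D, ∃! ω : A →ₗ[ℂ] ℂ, ω ∈ pureStates A ∧ ∀ x : D, ω x = θ x

section CStar

variable {A : Type*} [CStarAlgebra A] [PartialOrder A] [StarOrderedRing A]

/-- `Φ : A → D` is a conditional expectation: a positive `D`-bimodule map that restricts to the
identity on `D`. -/
structure IsConditionalExpectation (D : StarSubalgebra ℂ A) (Φ : A →ₗ[ℂ] D) : Prop where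
  nonneg : ∀ a : A, 0 ≤ a → 0 ≤ (Φ a : A)
  apply_coe : ∀ x : D, Φ (x : A) = x
  bimodule : ∀ (x y : D) (a : A), Φ ((x : A) * a * (y : A)) = x * Φ a * y

/-- A positive map `Φ : A → D` is faithful if `a ≥ 0` and `Φ a = 0` imply `a = 0`. -/
def IsFaithful (D : StarSubalgebra ℂ A) (Φ : A →ₗ[ℂ] D) : Prop :=
  ∀ a : A, 0 ≤ a → Φ a = 0 → a = 0

/-- `(D ⊂ A)` is a unital Cartan pair. Non-degeneracy (`D` contains an approximate unit of `A`)
holds because a `StarSubalgebra` contains `1`. -/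
structure IsCartanPair (D : StarSubalgebra ℂ A) : Prop where
  isClosed : IsClosed (D : Set A)
  masa : IsMasa D
  regular : (StarAlgebra.adjoin ℂ (normalisers D)).topologicalClosure = ⊤
  exists_expectation : ∃ Φ : A →ₗ[ℂ] D, IsConditionalExpectation D Φ ∧ IsFaithful D Φ

/-- `(D ⊂ A)` is a unital diagonal pair. -/
structure IsDiagonalPair (D : StarSubalgebra ℂ A) : Prop extends IsCartanPair D where
  uniqueExtension : UniqueExtensionProperty D

/-- `Φ` is the conditional expectation associated with a Cartan pair `(D ⊂ A)`, that is, the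
(unique) faithful conditional expectation onto `D`. -/
structure IsAssociatedExpectation (D : StarSubalgebra ℂ A) (Φ : A →ₗ[ℂ] D) : Prop extends
    IsConditionalExpectation D Φ where
  faithful : IsFaithful D Φ

/-- `H` is a hereditary sub-C⋆-algebra of `A`. -/
structure IsHereditarySubalgebra (H : NonUnitalStarSubalgebra ℂ A) : Prop where
  isClosed : IsClosed (H : Set A)
  hereditary : ∀ x y : A, y ∈ H → 0 ≤ x → x ≤ y → x ∈ H

/-- `her a`: the hereditary sub-C⋆-algebra of `A` generated by `a`. -/
noncomputable def her (a : A) : NonUnitalStarSubalgebra ℂ A :=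
  sInf {H | IsHereditarySubalgebra H ∧ a ∈ H}

/-- A positive map `Φ : A → D` is hereditary if `a ∈ her (Φ a)` for every positive `a`. -/
def IsHereditaryMap (D : StarSubalgebra ℂ A) (Φ : A →ₗ[ℂ] D) : Prop :=
  ∀ a : A, 0 ≤ a → a ∈ her (Φ a : A)

/-- A positive linear map has order zero if it maps orthogonal positive elements to orthogonal
elements. -/
def IsOrderZero {B : Type*} [CStarAlgebra B] [PartialOrder B] [StarOrderedRing B]
    (φ : B →ₗ[ℂ] A) : Prop :=
  ∀ x y : B, 0 ≤ x → 0 ≤ y → x * y = 0 → φ x * φ y = 0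

end CStar

/-- A finite-dimensional C⋆-algebra with its canonical order, together with a masa. -/
structure FinDimPair where
  carrier : Type
  [cstar : CStarAlgebra carrier]
  [order : PartialOrder carrier]
  [starOrdered : StarOrderedRing carrier]
  [finDim : FiniteDimensional ℂ carrier]
  masa : StarSubalgebra ℂ carrier
  isMasa : IsMasa masa

attribute [instance] FinDimPair.cstar FinDimPair.order FinDimPair.starOrdered FinDimPair.finDim

section DiagDim

variable {A : Type*} [CStarAlgebra A] [PartialOrder A] [StarOrderedRing A]

/-- The diagonal dimension of `(D ⊂ A)` is at most `d`: for every finite `S ⊂ A` and `ε > 0` there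
are finite-dimensional C⋆-algebras with masas `(D_{F i} ⊂ F i)`, `i = 0, …, d`, and c.p. maps
`ψ : A → ⨁ i, F i` and `φ : ⨁ i, F i → A`, with `ψ` contractive and mapping `D` into
`⨁ i, D_{F i}`, such that `φ ∘ ψ` is within `ε` of the identity on `S` and each restriction
`φ|_{F i}` is contractive, of order zero, and maps normalisers of `D_{F i}` to normalisers
of `D`. -/
def DiagDimLE (D : StarSubalgebra ℂ A) (d : ℕ) : Prop :=
  ∀ (S : Finset A) (ε : ℝ), 0 < ε →
    ∃ (F : Fin (d + 1) → FinDimPair)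
      (ψ : A →CP ((i : Fin (d + 1)) → (F i).carrier))
      (φ : ((i : Fin (d + 1)) → (F i).carrier) →CP A),
      (∀ a : A, ‖ψ a‖ ≤ ‖a‖) ∧
      (∀ a ∈ S, ‖φ (ψ a) - a‖ < ε) ∧
      (∀ x ∈ D, ∀ i, ψ x i ∈ (F i).masa) ∧
      (∀ (i : Fin (d + 1)) (x : (F i).carrier), ‖φ (Pi.single i x)‖ ≤ ‖x‖) ∧
      (∀ i : Fin (d + 1), IsOrderZero
        (φ.toLinearMap ∘ₗ LinearMap.single ℂ (fun j => (F j).carrier) i)) ∧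
      (∀ (i : Fin (d + 1)), ∀ v ∈ normalisers (F i).masa,
        φ (Pi.single i v) ∈ normalisers D)

/-- The diagonal dimension of `(D ⊂ A)`: the least `d` with `DiagDimLE D d`, and `⊤` if there is
none. -/
noncomputable def diagDim (D : StarSubalgebra ℂ A) : ℕ∞ :=
  ⨅ (d : ℕ) (_ : DiagDimLE D d), (d : ℕ∞)

end DiagDim

end DiagonalPair

/-!
The point is the estimate `a ≤ C • Φ a + ε • 1` for every `a ≥ 0` and `ε > 0`, which forces `a` into
every hereditary subalgebra containing `Φ a`.

Let `φ` be the restriction of an approximating map to one summand of `F`, and let `(e k)` be a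
finite family of normalisers in that summand with `∑ k, e k (e k)⋆ = 1` whose coefficients
`(e k)⋆ x (e l)` lie in the masa. With `v k = φ (e k)`, the map
`y ↦ ∑ k, ∑ l, v k Φ((v k)⋆ y (v l)) (v l)⋆` is positive and, because `φ` has order zero, sends
`φ x` to `φ(1)⁴ φ x` and `1` to `φ(1)⁴`. On the other hand, `v Φ(v⋆ a v) v⋆ = (v v⋆)² Φ a` for every
normaliser `v`, since both sides are essentially `D`-bimodule maps that agree at `1` and such a map
is determined on normalisers by its value at `1`; hence the map is dominated by a multiple of `Φ`.
From `φ x ≤ a + δ • 1` one obtains `φ(1)⁴ φ x ≤ C • Φ a + δ • φ(1)⁴`. The factor `φ(1)⁴` is removed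
by functional calculus of `φ 1`, and the estimates are summed over the summands.
-/

namespace DiagonalPair

open scoped ComplexOrder CStarAlgebra

section Masa

variable {A : Type*} [Ring A] [StarRing A] [Algebra ℂ A] [StarModule ℂ A] {D : StarSubalgebra ℂ A}

lemma IsMasa.commute (hD : IsMasa D) {x y : A} (hx : x ∈ D) (hy : y ∈ D) : Commute x y :=
  hD.prop x hx y hy

lemma IsMasa.mem_of_isSelfAdjoint_of_commute (hD : IsMasa D) {y : A} (hy : IsSelfAdjoint y)
    (h : ∀ x ∈ D, Commute x y) : y ∈ D := by
  set s : Set A := insert y (D : Set A)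
  have hcomm : ∀ a ∈ s, ∀ b ∈ s, a * b = b * a := by
    rintro a (rfl | ha) b (rfl | hb)
    · rfl
    · exact (h b hb).symm
    · exact h a ha
    · exact hD.commute ha hb
  have hstar : ∀ b ∈ s, star b ∈ s := by
    rintro b (rfl | hb)
    · exact .inl hy.star_eq
    · exact .inr (star_mem hb)
  have hadj := StarAlgebra.isMulCommutative_adjoin ℂ hcomm
    fun a ha b hb => hcomm a ha _ (hstar b hb)
  refine hD.le_of_ge ?_ (fun x hx => StarAlgebra.subset_adjoin ℂ s (.inr hx))
    (StarAlgebra.subset_adjoin ℂ s (.inl rfl))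
  exact fun x hx z hz => congrArg Subtype.val (hadj.is_comm.comm ⟨x, hx⟩ ⟨z, hz⟩)

lemma IsMasa.mem_of_commute (hD : IsMasa D) {y : A} (h : ∀ x ∈ D, Commute x y) : y ∈ D := by
  have hstar : ∀ x ∈ D, Commute x (star y) := fun x hx => by
    simpa using (h (star x) (star_mem hx)).star_star
  rw [← realPart_add_I_smul_imaginaryPart y, realPart_apply_coe, imaginaryPart_apply_coe]
  refine add_mem ?_ (SMulMemClass.smul_mem _ ?_) <;>
    refine hD.mem_of_isSelfAdjoint_of_commute ?_ fun x hx => ?_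
  · exact realPart_apply_coe y ▸ (realPart y).2
  · exact ((h x hx).add_right (hstar x hx)).smul_right _
  · exact imaginaryPart_apply_coe y ▸ (imaginaryPart y).2
  · exact (((h x hx).sub_right (hstar x hx)).smul_right _).smul_right _

lemma IsMasa.coe_eq_centralizer (hD : IsMasa D) : (D : Set A) = Set.centralizer D :=
  Set.Subset.antisymm (fun _ hx _ hy => hD.commute hy hx) fun _ hx => hD.mem_of_commute hx

lemma IsMasa.isClosed [TopologicalSpace A] [T2Space A] [SeparatelyContinuousMul A]
    (hD : IsMasa D) : IsClosed (D : Set A) :=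
  hD.coe_eq_centralizer ▸ Set.isClosed_centralizer _

lemma mem_normalisers_of_mem {v : A} (hv : v ∈ D) : v ∈ normalisers D := fun _ hx =>
  ⟨mul_mem (mul_mem hv hx) (star_mem hv), mul_mem (mul_mem (star_mem hv) hx) hv⟩

lemma star_mul_self_mem {v : A} (hv : v ∈ normalisers D) : star v * v ∈ D := by
  simpa using (hv 1 (one_mem D)).2

lemma mul_star_self_mem {v : A} (hv : v ∈ normalisers D) : v * star v ∈ D := by
  simpa using (hv 1 (one_mem D)).1

end Masa

section BimoduleMap

/-- A linear map `T : A → A` with values in `D` that is `D`-bilinear. A conditional expectation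
onto `D` is regarded as such a map by composing it with the inclusion `D ⊂ A`. -/
structure IsBimoduleMap {A : Type*} [Ring A] [StarRing A] [Algebra ℂ A] [StarModule ℂ A]
    (D : StarSubalgebra ℂ A) (T : A →ₗ[ℂ] A) : Prop where
  map_mem : ∀ a, T a ∈ D
  map_mul_left : ∀ x ∈ D, ∀ a, T (x * a) = x * T a
  map_mul_right : ∀ x ∈ D, ∀ a, T (a * x) = T a * x

lemma IsBimoduleMap.map_of_mem {A : Type*} [Ring A] [StarRing A] [Algebra ℂ A] [StarModule ℂ A]
    {D : StarSubalgebra ℂ A} {T : A →ₗ[ℂ] A} (hT : IsBimoduleMap D T) {x : A} (hx : x ∈ D) :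
    T x = T 1 * x := by
  simpa using hT.map_mul_right x hx 1

variable {A : Type*} [CStarAlgebra A] {D : StarSubalgebra ℂ A} {T : A →ₗ[ℂ] A}

lemma star_mul_eq_zero_of_mul_star_mul_eq_zero {v w : A} (h : v * star v * w = 0) :
    star v * w = 0 := by
  rw [← CStarRing.star_mul_self_eq_zero_iff, star_mul, star_star, mul_assoc, ← mul_assoc v, h,
    mul_zero]

lemma IsMasa.mem_of_conj_eq (hD : IsMasa D) {b : A}
    (h : ∀ x ∈ D, b * x * star b = x * (b * star b)) : b ∈ D := by
  refine hD.mem_of_commute fun x hx => ?_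
  have hbx : b * star b * star x = star x * (b * star b) := by
    have := congrArg star (h x hx)
    simp only [star_mul, star_star, ← mul_assoc] at this
    rw [← this, h _ (star_mem hx)]
  have hzero : (x * b - b * x) * star (x * b - b * x) = 0 := by
    calc (x * b - b * x) * star (x * b - b * x)
        = x * (b * star b * star x) - x * (b * star x * star b) - b * x * star b * star x
          + b * (x * star x) * star b := by simp only [star_sub, star_mul]; noncomm_ring
      _ = 0 := by
          rw [h _ (star_mem hx), h x hx, h _ (mul_mem hx (star_mem hx)), mul_assoc x _ (star x),
            hbx]
          noncomm_ring
  exact sub_eq_zero.mp ((CStarRing.mul_star_self_eq_zero_iff _).mp hzero)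

lemma IsBimoduleMap.star_map_mul_mem (hD : IsMasa D) (hT : IsBimoduleMap D T) {u : A}
    (hu : u ∈ normalisers D) : star (T u) * u ∈ D := by
  have hq := star_mul_self_mem hu
  have hE := hT.map_mem u
  -- Evaluate `T` on `(u x u⋆) u = u (u⋆ u x)`.
  have hconj : ∀ x ∈ D, u * x * star u * T u = x * (star u * u * T u) := fun x hx => by
    calc u * x * star u * T u = T (u * (star u * u * x)) := by
          rw [← hT.map_mul_left (u * x * star u) (hu x hx).1, (hD.commute hq hx).eq]
          simp only [mul_assoc]
      _ = x * (star u * u * T u) := by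
          rw [hT.map_mul_right _ (mul_mem hq hx), (hD.commute hE (mul_mem hq hx)).eq,
            (hD.commute hq hx).eq, mul_assoc]
  refine hD.mem_of_conj_eq fun x hx => ?_
  calc star (T u) * u * x * star (star (T u) * u)
      = star (T u) * (u * x * star u * T u) := by simp only [star_mul, star_star, mul_assoc]
    _ = x * star (T u) * (u * 1 * star u * T u) := by
        rw [hconj x hx, hconj 1 (one_mem D), ← mul_assoc, (hD.commute (star_mem hE) hx).eq, one_mul]
    _ = x * (star (T u) * u * star (star (T u) * u)) := by
        simp only [star_mul, star_star, mul_assoc, mul_one]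

lemma IsBimoduleMap.map_normaliser_eq_zero (hD : IsMasa D) (hT : IsBimoduleMap D T) (h1 : T 1 = 0)
    {u : A} (hu : u ∈ normalisers D) : T u = 0 := by
  rw [← CStarRing.star_mul_self_eq_zero_iff, ← hT.map_mul_left _ (star_mem (hT.map_mem u)),
    hT.map_of_mem (hT.star_map_mul_mem hD hu), h1, zero_mul]

lemma IsBimoduleMap.eq_zero (hD : IsMasa D) (hT : IsBimoduleMap D T) (hcont : Continuous T)
    (h1 : T 1 = 0) (hspan : (Submodule.span ℂ (normalisers D)).topologicalClosure = ⊤) : T = 0 :=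
  LinearMap.ext fun z => by
    have hker : IsClosed (LinearMap.ker T : Set A) := isClosed_singleton.preimage hcont
    have hle : Submodule.span ℂ (normalisers D) ≤ LinearMap.ker T :=
      Submodule.span_le.mpr fun u hu => hT.map_normaliser_eq_zero hD h1 hu
    exact Submodule.topologicalClosure_minimal _ hle hker (hspan ▸ Submodule.mem_top : z ∈ _)

end BimoduleMap

section Expectation

variable {A : Type*} [CStarAlgebra A] {D : StarSubalgebra ℂ A} {Φ : A →ₗ[ℂ] D}

/-- `T a = g v Φ(v⋆ a v) v⋆ g - g⁴ Φ(a)` with `g = v v⋆`. The outer factors `g` make `T` a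
`D`-bimodule map, although `a ↦ v Φ(v⋆ a v) v⋆` is not visibly one. -/
noncomputable def conjDefect (Φ : A →ₗ[ℂ] D) (v : A) : A →ₗ[ℂ] A :=
  LinearMap.mulLeftRight ℂ (v * star v * v, star v * (v * star v)) ∘ₗ
      D.subtype.toLinearMap ∘ₗ Φ ∘ₗ LinearMap.mulLeftRight ℂ (star v, v)
    - LinearMap.mulLeft ℂ ((v * star v) ^ 4) ∘ₗ D.subtype.toLinearMap ∘ₗ Φ

lemma conjDefect_apply (Φ : A →ₗ[ℂ] D) (v a : A) :
    conjDefect Φ v a = v * star v * v * Φ (star v * a * v) * (star v * (v * star v))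
      - (v * star v) ^ 4 * Φ a := rfl

variable [PartialOrder A]

lemma IsConditionalExpectation.isBimoduleMap (hΦ : IsConditionalExpectation D Φ) :
    IsBimoduleMap D (D.subtype.toLinearMap ∘ₗ Φ) where
  map_mem a := (Φ a).2
  map_mul_left x hx a := by
    simpa using congrArg (Subtype.val : D → A) (hΦ.bimodule ⟨x, hx⟩ 1 a)
  map_mul_right x hx a := by
    simpa using congrArg (Subtype.val : D → A) (hΦ.bimodule 1 ⟨x, hx⟩ a)

lemma IsConditionalExpectation.map_of_mem (hΦ : IsConditionalExpectation D Φ) {x : A}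
    (hx : x ∈ D) : (Φ x : A) = x :=
  congrArg (Subtype.val : D → A) (hΦ.apply_coe ⟨x, hx⟩)

lemma IsConditionalExpectation.map_mul_left (hΦ : IsConditionalExpectation D Φ) {x : A}
    (hx : x ∈ D) (a : A) : (Φ (x * a) : A) = x * Φ a :=
  hΦ.isBimoduleMap.map_mul_left x hx a

lemma IsConditionalExpectation.map_mul_right (hΦ : IsConditionalExpectation D Φ) {x : A}
    (hx : x ∈ D) (a : A) : (Φ (a * x) : A) = Φ a * x :=
  hΦ.isBimoduleMap.map_mul_right x hx a

lemma IsConditionalExpectation.normaliser_mul_map_conj_mul (hD : IsMasa D)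
    (hΦ : IsConditionalExpectation D Φ) {v x : A} (hv : v ∈ normalisers D) (hx : x ∈ D) (a : A) :
    v * star v * v * (Φ (star v * (x * a) * v) : A)
      = x * (v * star v * v * (Φ (star v * a * v) : A)) := by
  have hgx := (hD.commute (mul_star_self_mem hv) hx).eq
  calc v * star v * v * (Φ (star v * (x * a) * v) : A)
      = v * Φ (star v * v * (star v * (x * a) * v)) := by
        rw [hΦ.map_mul_left (star_mul_self_mem hv)]; simp only [mul_assoc]
    _ = v * Φ (star v * (v * star v * x) * a * v) := by simp only [mul_assoc]
    _ = v * Φ (star v * x * v * (star v * a * v)) := by rw [hgx]; simp only [mul_assoc]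
    _ = v * star v * x * v * Φ (star v * a * v) := by
        rw [hΦ.map_mul_left (hv x hx).2]; simp only [mul_assoc]
    _ = x * (v * star v * v * (Φ (star v * a * v) : A)) := by rw [hgx]; simp only [mul_assoc]

variable [StarOrderedRing A]

lemma IsConditionalExpectation.continuous (hΦ : IsConditionalExpectation D Φ) :
    Continuous fun a => (Φ a : A) :=
  map_continuous (PositiveLinearMap.mk₀ (D.subtype.toLinearMap ∘ₗ Φ) hΦ.nonneg)

lemma IsConditionalExpectation.map_star (hΦ : IsConditionalExpectation D Φ) (a : A) :
    (Φ (star a) : A) = star (Φ a : A) :=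
  StarHomClass.map_star (PositiveLinearMap.mk₀ (D.subtype.toLinearMap ∘ₗ Φ) hΦ.nonneg) a

lemma IsConditionalExpectation.map_conj_mul_star_normaliser (hD : IsMasa D)
    (hΦ : IsConditionalExpectation D Φ) {v x : A} (hv : v ∈ normalisers D) (hx : x ∈ D) (a : A) :
    (Φ (star v * (a * x) * v) : A) * (star v * (v * star v))
      = (Φ (star v * a * v) : A) * (star v * (v * star v)) * x := by
  simpa [← hΦ.map_star, mul_assoc] using
    congrArg star (hΦ.normaliser_mul_map_conj_mul hD hv (star_mem hx) (star a))

lemma IsConditionalExpectation.isBimoduleMap_conjDefect (hD : IsMasa D)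
    (hΦ : IsConditionalExpectation D Φ) {v : A} (hv : v ∈ normalisers D) :
    IsBimoduleMap D (conjDefect Φ v) := by
  have hg := mul_star_self_mem hv
  refine ⟨fun a => sub_mem ?_ (mul_mem (pow_mem hg 4) (Φ a).2), fun x hx a => ?_, fun x hx a => ?_⟩
  · have hmem : v * star v * v * (Φ (star v * a * v) : A) * (star v * (v * star v)) ∈ D := by
      simpa only [mul_assoc] using mul_mem (mul_mem hg (hv _ (Φ (star v * a * v)).2).1) hg
    exact hmem
  · simp only [conjDefect_apply]
    rw [hΦ.normaliser_mul_map_conj_mul hD hv hx, hΦ.map_mul_left hx, mul_sub, ← mul_assoc (_ ^ 4),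
      (hD.commute (pow_mem hg 4) hx).eq]
    simp only [mul_assoc]
  · simp only [conjDefect_apply]
    rw [mul_assoc, hΦ.map_conj_mul_star_normaliser hD hv hx, hΦ.map_mul_right hx, sub_mul]
    simp only [mul_assoc]

lemma IsConditionalExpectation.conjDefect_eq_zero (hD : IsMasa D)
    (hΦ : IsConditionalExpectation D Φ)
    (hspan : (Submodule.span ℂ (normalisers D)).topologicalClosure = ⊤)
    {v : A} (hv : v ∈ normalisers D) : conjDefect Φ v = 0 := by
  refine (hΦ.isBimoduleMap_conjDefect hD hv).eq_zero hD ?_ ?_ hspan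
  · have hcont := hΦ.continuous
    have hconj : Continuous fun a => (Φ (star v * a * v) : A) := hcont.comp (by fun_prop)
    exact ((hconj.const_mul _).mul_const _).sub (hcont.const_mul _)
  · rw [conjDefect_apply, mul_one, hΦ.map_of_mem (star_mul_self_mem hv),
      hΦ.map_of_mem (one_mem D)]
    noncomm_ring

lemma IsConditionalExpectation.normaliser_mul_map_conj_mul_star (hD : IsMasa D)
    (hΦ : IsConditionalExpectation D Φ)
    (hspan : (Submodule.span ℂ (normalisers D)).topologicalClosure = ⊤)
    {v : A} (hv : v ∈ normalisers D) (a : A) :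
    v * Φ (star v * a * v) * star v = (v * star v) ^ 2 * Φ a := by
  set g := v * star v with hgdef
  have hg : g ∈ D := mul_star_self_mem hv
  have hgs : star g = g := by simp [hgdef]
  set w := v * Φ (star v * a * v) * star v - g ^ 2 * Φ a with hw
  have hwD : w ∈ D := sub_mem (hv _ (Φ _).2).1 (mul_mem (pow_mem hg 2) (Φ a).2)
  have hggw : g * star g * w = 0 := by
    have h := LinearMap.congr_fun (hΦ.conjDefect_eq_zero hD hspan hv) a
    rw [conjDefect_apply, LinearMap.zero_apply, ← hgdef, sub_eq_zero] at h
    rw [hgs, mul_assoc, (hD.commute hg hwD).eq, hw, sub_mul, mul_sub, sub_eq_zero,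
      mul_assoc (g ^ 2), ← (hD.commute hg (Φ a).2).eq]
    simp only [← mul_assoc] at h ⊢
    rw [h]
    noncomm_ring
  have hgw : g * w = 0 := by simpa [hgs] using star_mul_eq_zero_of_mul_star_mul_eq_zero hggw
  have hvw : star w * v = 0 := by
    simpa using congrArg star (star_mul_eq_zero_of_mul_star_mul_eq_zero hgw)
  have hww : star w * w = 0 := by
    rw [hw, mul_sub, ← hw, sq, hgdef]
    simp only [← mul_assoc, hvw, zero_mul, sub_self]
  exact sub_eq_zero.mp ((CStarRing.star_mul_self_eq_zero_iff w).mp hww)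

end Expectation

section PositiveMatrix

lemma exists_eq_star_mul_self {C : Type*} [NonUnitalCStarAlgebra C] [PartialOrder C]
    [StarOrderedRing C] {c : C} (hc : 0 ≤ c) : ∃ s : C, c = star s * s :=
  CStarAlgebra.nonneg_iff_eq_star_mul_self.mp hc

lemma exists_conj_eq_neg_pow_three {C : Type*} [CStarAlgebra C] [PartialOrder C]
    [StarOrderedRing C] {c : C} (hc : IsSelfAdjoint c) :
    ∃ n : C, 0 ≤ n ∧ star n * c * n = -n ^ 3 ∧ (n ^ 3 = 0 → 0 ≤ c) := by
  have hn0 : 0 ≤ c⁻ := CFC.negPart_nonneg c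
  have hns : IsSelfAdjoint c⁻ := .of_nonneg hn0
  refine ⟨c⁻, hn0, ?_, fun hcube => ?_⟩
  · have hmul : c⁻ * c = -(c⁻ * c⁻) := by
      nth_rewrite 2 [← CFC.posPart_sub_negPart c hc]
      rw [mul_sub, CFC.negPart_mul_posPart, zero_sub]
    rw [hns.star_eq, hmul]
    noncomm_ring
  · have hnorm := hns.nnnorm_pow_two_pow 2
    rw [show 2 ^ 2 = 3 + 1 from rfl, pow_succ, hcube, zero_mul, nnnorm_zero, eq_comm] at hnorm
    have hn_zero : c⁻ = 0 := nnnorm_eq_zero.mp (eq_zero_of_pow_eq_zero hnorm)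
    rw [← CFC.posPart_sub_negPart c hc, hn_zero, sub_zero]
    exact CFC.posPart_nonneg c

lemma sum_star_mul_gram_mul {R ι κ : Type*} [NonUnitalSemiring R] [StarRing R] [Fintype ι]
    [Fintype κ] (S : κ → ι → R) (b : ι → R) :
    ∑ k, ∑ l, star (b k) * (∑ m, star (S m k) * S m l) * b l
      = ∑ m, star (∑ k, S m k * b k) * ∑ l, S m l * b l := by
  simp only [star_sum, star_mul, Finset.mul_sum, Finset.sum_mul, mul_assoc]
  rw [Finset.sum_congr rfl fun k _ => Finset.sum_comm, Finset.sum_comm]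
  exact Finset.sum_congr rfl fun m _ => Finset.sum_comm

variable {A : Type*} [CStarAlgebra A] [PartialOrder A] [StarOrderedRing A]
  {ι : Type*} [Fintype ι] {M : CStarMatrix ι ι A}

lemma exists_eq_sum_star_mul (hM : 0 ≤ M) :
    ∃ S : ι → ι → A, ∀ k l, M k l = ∑ m, star (S m k) * S m l := by
  obtain ⟨S, rfl⟩ := exists_eq_star_mul_self hM
  exact ⟨S, fun k l => CStarMatrix.mul_apply⟩

lemma mul_eq_zero_of_diag_mul_eq_zero (hM : 0 ≤ M) {k : ι} {b : A} (h : M k k * b = 0) (l : ι) :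
    M l k * b = 0 := by
  obtain ⟨S, hS⟩ := exists_eq_sum_star_mul hM
  have hsum : ∑ m, star (S m k * b) * (S m k * b) = 0 := by
    simp only [star_mul, mul_assoc, ← Finset.mul_sum]
    simp only [← mul_assoc, ← Finset.sum_mul, ← hS]
    rw [mul_assoc, h, mul_zero]
  have hzero : ∀ m, S m k * b = 0 := fun m => (CStarRing.star_mul_self_eq_zero_iff _).mp <|
    (Finset.sum_eq_zero_iff_of_nonneg fun m _ => star_mul_self_nonneg _).mp hsum m
      (Finset.mem_univ m)
  simp only [hS, Finset.sum_mul, mul_assoc, hzero, mul_zero, Finset.sum_const_zero]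

lemma sum_star_mul_mul_nonneg (hM : 0 ≤ M) (b : ι → A) :
    0 ≤ ∑ k, ∑ l, star (b k) * M k l * b l := by
  obtain ⟨S, hS⟩ := exists_eq_sum_star_mul hM
  simp only [hS, sum_star_mul_gram_mul]
  exact Finset.sum_nonneg fun m _ => star_mul_self_nonneg _

lemma star_sum_mul_sum_le (s : ι → A) :
    star (∑ k, s k) * ∑ k, s k ≤ (Fintype.card ι : ℝ) • ∑ k, star (s k) * s k := by
  have hpos : 0 ≤ ∑ k, ∑ l, star (s k - s l) * (s k - s l) :=
    Finset.sum_nonneg fun k _ => Finset.sum_nonneg fun l _ => star_mul_self_nonneg _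
  have hsum : ∑ k, ∑ l, star (s k - s l) * (s k - s l)
      = (2 : ℝ) • ((Fintype.card ι : ℝ) • ∑ k, star (s k) * s k
        - star (∑ k, s k) * ∑ k, s k) := by
    simp only [star_sub, sub_mul, mul_sub, Finset.sum_sub_distrib, Finset.sum_const,
      ← Finset.sum_mul, ← Finset.mul_sum, ← star_sum, ← Finset.smul_sum, Finset.card_univ,
      ← Nat.cast_smul_eq_nsmul ℝ]
    module
  rwa [hsum, smul_nonneg_iff_nonneg_of_pos_left two_pos, sub_nonneg] at hpos

lemma sum_star_mul_mul_le_diag (hM : 0 ≤ M) (b : ι → A) :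
    ∑ k, ∑ l, star (b k) * M k l * b l
      ≤ (Fintype.card ι : ℝ) • ∑ k, star (b k) * M k k * b k := by
  obtain ⟨S, hS⟩ := exists_eq_sum_star_mul hM
  simp only [hS, sum_star_mul_gram_mul]
  refine (Finset.sum_le_sum fun m _ => star_sum_mul_sum_le _).trans_eq ?_
  rw [← Finset.smul_sum, Finset.sum_comm]
  simp only [star_mul, Finset.mul_sum, Finset.sum_mul, mul_assoc]

lemma cstarMatrix_nonneg (hM : IsSelfAdjoint M)
    (hpos : ∀ b : ι → A, 0 ≤ ∑ k, ∑ l, star (b k) * M k l * b l) : 0 ≤ M := by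
  classical
  obtain ⟨N, hN0, hNMN, hM0⟩ := exists_conj_eq_neg_pow_three hM
  -- The diagonal entries of `N³ ≥ 0` are at most zero by `hpos` applied to the columns of `N`.
  have hdiag : ∀ j, (N ^ 3) j j = 0 := fun j => by
    have hcol : ∑ k, ∑ l, star (N k j) * M k l * N l j = -(N ^ 3) j j := by
      rw [← CStarMatrix.neg_apply, ← hNMN]
      simp only [CStarMatrix.mul_apply, CStarMatrix.star_apply, Finset.sum_mul]
      exact Finset.sum_comm
    obtain ⟨S, hS⟩ := exists_eq_sum_star_mul (CStarAlgebra.pow_nonneg hN0 3)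
    refine le_antisymm (Left.nonneg_neg_iff.mp (hcol ▸ hpos fun k => N k j)) ?_
    exact hS j j ▸ Finset.sum_nonneg fun m _ => star_mul_self_nonneg _
  refine hM0 (CStarMatrix.ext fun l j => ?_)
  simpa using mul_eq_zero_of_diag_mul_eq_zero (CStarAlgebra.pow_nonneg hN0 3) (b := 1)
    (by rw [hdiag, zero_mul]) l

/-- The matrix `[v k⋆ z v l]` over `A`, by which complete positivity of a map is tested. -/
def conjMatrix {A ι : Type*} [Mul A] [Star A] (z : A) (v : ι → A) : CStarMatrix ι ι A :=
  CStarMatrix.ofMatrix fun k l => star (v k) * z * v l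

lemma conjMatrix_apply {A ι : Type*} [Mul A] [Star A] (z : A) (v : ι → A) (k l : ι) :
    conjMatrix z v k l = star (v k) * z * v l := rfl

lemma conjMatrix_nonneg {z : A} (hz : 0 ≤ z) (v : ι → A) : 0 ≤ conjMatrix z v := by
  refine cstarMatrix_nonneg (CStarMatrix.ext fun k l => ?_) fun b => ?_
  · simp [CStarMatrix.star_apply, conjMatrix_apply, (IsSelfAdjoint.of_nonneg hz).star_eq, mul_assoc]
  · refine (star_left_conjugate_nonneg hz (∑ k, v k * b k)).trans_eq ?_
    simp only [conjMatrix_apply, star_sum, star_mul, Finset.sum_mul, Finset.mul_sum, mul_assoc]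
    exact Finset.sum_comm

end PositiveMatrix

section OrderZero

variable {F A : Type*} [CStarAlgebra F] [PartialOrder F] [StarOrderedRing F]
  [CStarAlgebra A] [PartialOrder A] [StarOrderedRing A] {φ : F →CP A}

lemma map_star_mul_mul_eq_zero (φ : F →CP A) {x : F} {b : A} (h : φ (star x * x) * b = 0) (y : F) :
    φ (star y * x) * b = 0 := by
  have hM := φ.map_cstarMatrix_nonneg _ (conjMatrix_nonneg zero_le_one ![x, y])
  simpa [conjMatrix_apply] using
    mul_eq_zero_of_diag_mul_eq_zero hM (k := 0) (b := b) (by simpa [conjMatrix_apply] using h) 1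

lemma map_mul_isStarProjection_mul_eq_zero (φ : F →CP A) {p : F} (hp : IsStarProjection p) {b : A}
    (h : φ p * b = 0) (y : F) : φ (y * p) * b = 0 := by
  have hpp : star p * p = p := by rw [hp.isSelfAdjoint.star_eq, hp.isIdempotentElem.eq]
  simpa using map_star_mul_mul_eq_zero φ (by rwa [hpp]) (star y)

lemma IsOrderZero.map_mul_map_isStarProjection (hφ : IsOrderZero φ.toLinearMap) {p : F}
    (hp : IsStarProjection p) (y : F) : φ y * φ p = φ (y * p) * φ 1 := by
  have hleft : φ (y * (1 - p)) * φ p = 0 :=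
    map_mul_isStarProjection_mul_eq_zero φ hp.one_sub
      (hφ (1 - p) p hp.one_sub_nonneg hp.nonneg hp.isIdempotentElem.one_sub_mul_self) y
  have hright : φ (y * p) * φ (1 - p) = 0 :=
    map_mul_isStarProjection_mul_eq_zero φ hp
      (hφ p (1 - p) hp.nonneg hp.one_sub_nonneg hp.isIdempotentElem.mul_one_sub_self) y
  rw [mul_sub, mul_one, map_sub, sub_mul, sub_eq_zero] at hleft
  rw [map_sub, mul_sub, sub_eq_zero] at hright
  rw [hleft, hright]

lemma finite_spectrum_real {F : Type*} [Ring F] [Algebra ℝ F] [FiniteDimensional ℝ F] (x : F) :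
    (spectrum ℝ x).Finite := by
  have hx : IsIntegral ℝ x := IsIntegral.of_finite ℝ x
  refine ((minpoly ℝ x).rootSet_finite ℝ).subset fun t ht => ?_
  rcases subsingleton_or_nontrivial F
  · simp [spectrum.of_subsingleton] at ht
  have hmem := spectrum.subset_polynomial_aeval x (minpoly ℝ x) ⟨t, ht, rfl⟩
  rw [minpoly.aeval, spectrum.zero_eq] at hmem
  simpa [Polynomial.mem_rootSet_of_ne (minpoly.ne_zero hx), Polynomial.aeval_def] using hmem

lemma mem_span_isStarProjection_of_finite_spectrum {F : Type*} [CStarAlgebra F] {x : F}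
    (hx : IsSelfAdjoint x) (hfin : (spectrum ℝ x).Finite) :
    x ∈ Submodule.span ℂ {p : F | IsStarProjection p} := by
  have hc : ∀ f : ℝ → ℝ, ContinuousOn f (spectrum ℝ x) := hfin.continuousOn
  have hproj : ∀ t, IsStarProjection (cfc (Pi.single t 1 : ℝ → ℝ) x) := fun t =>
    { isIdempotentElem := by
        rw [IsIdempotentElem, ← cfc_mul _ _ _ (hc _) (hc _)]
        refine cfc_congr fun u _ => ?_
        by_cases h : u = t <;> simp [h]
      isSelfAdjoint := cfc_predicate _ _ }
  have hdecomp : x = ∑ t ∈ hfin.toFinset, (t : ℂ) • cfc (Pi.single t 1 : ℝ → ℝ) x := by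
    simp only [Complex.coe_smul, ← cfc_const_mul _ _ x (hc _)]
    rw [← cfc_sum _ _ _ fun t _ => hc _]
    conv_lhs => rw [← cfc_id ℝ x]
    refine cfc_congr fun u hu => ?_
    simp [Finset.sum_apply, Pi.single_apply, hu]
  rw [hdecomp]
  exact Submodule.sum_mem _ fun t _ => Submodule.smul_mem _ _ (Submodule.subset_span (hproj t))

lemma span_isStarProjection_eq_top (F : Type*) [CStarAlgebra F] [FiniteDimensional ℂ F] :
    Submodule.span ℂ {p : F | IsStarProjection p} = ⊤ := by
  have : FiniteDimensional ℝ F := Module.Finite.trans ℂ F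
  refine eq_top_iff.mpr fun x _ => ?_
  rw [← realPart_add_I_smul_imaginaryPart x]
  exact add_mem
    (mem_span_isStarProjection_of_finite_spectrum (realPart x).2 (finite_spectrum_real _))
    (Submodule.smul_mem _ _ <|
      mem_span_isStarProjection_of_finite_spectrum (imaginaryPart x).2 (finite_spectrum_real _))

lemma IsOrderZero.map_mul_map [FiniteDimensional ℂ F] (hφ : IsOrderZero φ.toLinearMap) (y x : F) :
    φ y * φ x = φ (y * x) * φ 1 := by
  have hx : x ∈ Submodule.span ℂ {p : F | IsStarProjection p} :=
    span_isStarProjection_eq_top F ▸ Submodule.mem_top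
  induction hx using Submodule.span_induction with
  | mem p hp => exact hφ.map_mul_map_isStarProjection hp y
  | zero => simp
  | add x z _ _ hx hz => simp only [map_add, mul_add, add_mul, hx, hz]
  | smul c x _ hx => simp only [map_smul, mul_smul_comm, smul_mul_assoc, hx]

lemma IsOrderZero.commute_map_one [FiniteDimensional ℂ F] (hφ : IsOrderZero φ.toLinearMap)
    (x : F) : Commute (φ 1) (φ x) :=
  (hφ.map_mul_map 1 x).trans (by rw [one_mul])

end OrderZero

section Projections

lemma mul_mem_normalisers {A : Type*} [Ring A] [StarRing A] [Algebra ℂ A] [StarModule ℂ A]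
    {D : StarSubalgebra ℂ A} {v w : A} (hv : v ∈ normalisers D) (hw : w ∈ normalisers D) :
    v * w ∈ normalisers D := fun x hx => by
  simpa only [star_mul, mul_assoc] using
    And.intro (hv _ (hw x hx).1).1 (hw _ (hv x hx).2).2

lemma star_mem_normalisers {A : Type*} [Ring A] [StarRing A] [Algebra ℂ A] [StarModule ℂ A]
    {D : StarSubalgebra ℂ A} {v : A} (hv : v ∈ normalisers D) : star v ∈ normalisers D :=
  fun x hx => by simpa only [star_star] using (hv x hx).symm

/-- A nonzero projection `p` is minimal if `p F p = ℂ p`. -/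
structure IsMinimalProjection {F : Type*} [Ring F] [StarRing F] [Algebra ℂ F] (p : F) : Prop
    extends IsStarProjection p where
  ne_zero : p ≠ 0
  exists_smul_eq : ∀ x, ∃ c : ℂ, p * x * p = c • p

/-- Murray–von Neumann equivalence of projections. -/
def MurrayVonNeumannEquiv {F : Type*} [Mul F] [Star F] (p q : F) : Prop :=
  ∃ e : F, e * star e = p ∧ star e * e = q

variable {F : Type*} [CStarAlgebra F] {p q r e : F}

lemma mul_star_mul_self_of_isStarProjection (h : IsStarProjection (star e * e)) :
    e * (star e * e) = e := by
  have hidem := h.isIdempotentElem.eq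
  rw [← sub_eq_zero, ← CStarRing.star_mul_self_eq_zero_iff]
  calc star (e * (star e * e) - e) * (e * (star e * e) - e)
      = star e * e * (star e * e) * (star e * e) - star e * e * (star e * e)
        - (star e * e * (star e * e) - star e * e) := by
        simp only [star_sub, star_mul, star_star]; noncomm_ring
    _ = 0 := by simp only [hidem, sub_self]

lemma MurrayVonNeumannEquiv.refl (hp : IsStarProjection p) : MurrayVonNeumannEquiv p p :=
  ⟨p, by simp [hp.isSelfAdjoint.star_eq, hp.isIdempotentElem.eq]⟩

lemma MurrayVonNeumannEquiv.symm (h : MurrayVonNeumannEquiv p q) : MurrayVonNeumannEquiv q p := by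
  obtain ⟨e, hp, hq⟩ := h
  exact ⟨star e, by rwa [star_star], by rwa [star_star]⟩

lemma MurrayVonNeumannEquiv.trans (hq : IsStarProjection q) (hpq : MurrayVonNeumannEquiv p q)
    (hqr : MurrayVonNeumannEquiv q r) : MurrayVonNeumannEquiv p r := by
  obtain ⟨e, rfl, he⟩ := hpq
  obtain ⟨f, hf, rfl⟩ := hqr
  have hee := mul_star_mul_self_of_isStarProjection (he ▸ hq)
  have hff := mul_star_mul_self_of_isStarProjection (e := star f) (by rwa [star_star, hf])
  refine ⟨e * f, ?_, ?_⟩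
  · rw [star_mul, mul_assoc, ← mul_assoc f, hf, ← he, ← mul_assoc, hee]
  · rw [star_mul, mul_assoc, ← mul_assoc (star e), he, ← mul_assoc, ← hf]
    simpa only [star_star] using congrArg (· * f) hff

lemma IsMinimalProjection.exists_pos_star_mul_self_eq [PartialOrder F] [StarOrderedRing F]
    (hq : IsMinimalProjection q) {y : F} (hy : y ≠ 0) (hyq : y * q = y) :
    ∃ t : ℝ, 0 < t ∧ star y * y = t • q := by
  obtain ⟨c, hc⟩ := hq.exists_smul_eq (star y * y)
  have hqy : q * star y = star y := by
    simpa [hq.isSelfAdjoint.star_eq] using congrArg star hyq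
  have hyy : star y * y = c • q := by rw [← hc, mul_assoc, mul_assoc, hyq, ← mul_assoc, hqy]
  have hyy' : star y * y = ‖c‖ • q := by
    rw [← CFC.abs_of_nonneg _ (star_mul_self_nonneg y), hyy, CFC.abs_smul,
      CFC.abs_of_nonneg _ hq.nonneg]
  refine ⟨‖c‖, norm_pos_iff.mpr fun h0 => hy ?_, hyy'⟩
  rwa [h0, zero_smul, CStarRing.star_mul_self_eq_zero_iff] at hyy

lemma IsMinimalProjection.murrayVonNeumannEquiv [PartialOrder F] [StarOrderedRing F]
    (hp : IsMinimalProjection p) (hq : IsMinimalProjection q) {x : F} (hx : p * x * q ≠ 0) :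
    MurrayVonNeumannEquiv p q := by
  set y := p * x * q with hy
  have hpy : p * y = y := by simp only [hy, ← mul_assoc, hp.isIdempotentElem.eq]
  have hyq : y * q = y := by simp only [hy, mul_assoc, hq.isIdempotentElem.eq]
  obtain ⟨t, ht, hyy⟩ := hq.exists_pos_star_mul_self_eq hx hyq
  set e := (√t)⁻¹ • y with he
  have hee : star e * e = q := by
    rw [he, star_smul, smul_mul_smul_comm, hyy, smul_smul, star_trivial, ← mul_inv,
      Real.mul_self_sqrt ht.le, inv_mul_cancel₀ ht.ne', one_smul]
  have hpe : p * e = e := by rw [he, mul_smul_comm, hpy]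
  have hep : star e * p = star e := by
    simpa [hp.isSelfAdjoint.star_eq] using congrArg star hpe
  obtain ⟨c, hc⟩ := hp.exists_smul_eq (e * star e)
  rw [← mul_assoc, hpe, mul_assoc, hep] at hc
  have hce : c • e = (1 : ℂ) • e := by
    rw [one_smul]
    nth_rewrite 1 [← hpe]
    rw [← smul_mul_assoc, ← hc, mul_assoc,
      mul_star_mul_self_of_isStarProjection (hee ▸ hq.toIsStarProjection)]
  have he0 : e ≠ 0 := fun h0 => hq.ne_zero (by rw [← hee, h0, mul_zero])
  exact ⟨e, by rw [hc, smul_left_injective ℂ he0 hce, one_smul], hee⟩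

end Projections

section FiniteDimensional

lemma IsMinimalProjection.map {B C : Type*} [Ring B] [StarRing B] [Algebra ℂ B] [Ring C]
    [StarRing C] [Algebra ℂ C] {p : B} (hp : IsMinimalProjection p) (f : B ≃⋆ₐ[ℂ] C) :
    IsMinimalProjection (f p) where
  toIsStarProjection := hp.toIsStarProjection.map f
  ne_zero := by simpa using hp.ne_zero
  exists_smul_eq x := by
    obtain ⟨c, hc⟩ := hp.exists_smul_eq (f.symm x)
    exact ⟨c, by rw [← map_smul, ← hc, map_mul, map_mul, f.apply_symm_apply]⟩

lemma isMinimalProjection_of_continuousMap {X : Type*} [TopologicalSpace X] [DecidableEq X]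
    {f : C(X, ℂ)} {x : X} (hf : ∀ y, f y = if y = x then 1 else 0) : IsMinimalProjection f where
  isIdempotentElem := ContinuousMap.ext fun y => by simp [hf]
  isSelfAdjoint := ContinuousMap.ext fun y => by simp [hf, apply_ite]
  ne_zero h := by simpa [hf] using congrArg (fun g : C(X, ℂ) => g x) h
  exists_smul_eq g := ⟨g x, ContinuousMap.ext fun y => by
    by_cases h : y = x <;> simp [hf, h]⟩

lemma exists_isMinimalProjection_sum_eq_one (B : Type*) [CommCStarAlgebra B]
    [FiniteDimensional ℂ B] :
    ∃ (n : ℕ) (p : Fin n → B), (∀ k, IsMinimalProjection (p k)) ∧ ∑ k, p k = 1 := by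
  classical
  let X := WeakDual.characterSpace ℂ B
  have : Finite (B →ₐ[ℂ] ℂ) := (linearIndependent_toLinearMap ℂ B ℂ).finite
  have : Finite X := Finite.of_equiv _ WeakDual.CharacterSpace.equivAlgHom.symm
  obtain ⟨n, ⟨e⟩⟩ := Finite.exists_equiv_fin X
  let f : Fin n → C(X, ℂ) := fun k =>
    ⟨fun y => if y = e.symm k then 1 else 0, continuous_of_discreteTopology⟩
  have hf : ∀ k, IsMinimalProjection (f k) := fun k =>
    isMinimalProjection_of_continuousMap fun _ => rfl
  have hsum : ∑ k, f k = 1 := ContinuousMap.ext fun y => by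
    simp [f, e.eq_symm_apply]
  refine ⟨n, fun k => (gelfandStarTransform B).symm (f k), fun k => (hf k).map _, ?_⟩
  rw [← map_sum, hsum, map_one]

section MinimalProjection

variable {F : Type*} [CStarAlgebra F] {D : StarSubalgebra ℂ F}

lemma IsMasa.isMinimalProjection_coe (hD : IsMasa D) {p : D} (hp : IsMinimalProjection p) :
    IsMinimalProjection (p : F) where
  toIsStarProjection := hp.toIsStarProjection.map D.subtype
  ne_zero := by simpa using hp.ne_zero
  exists_smul_eq x := by
    have hcorner : ∀ y : D, ∃ c : ℂ, (p : F) * y = c • p ∧ (y : F) * p = c • p := fun y => by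
      obtain ⟨c, hc⟩ := hp.exists_smul_eq y
      have hpp : (p * p : F) = p := congrArg Subtype.val hp.isIdempotentElem.eq
      have hpy : (p * y : F) = y * p := hD.commute p.2 y.2
      have hpyp : (p * y * p : F) = c • p := congrArg Subtype.val hc
      exact ⟨c, by rw [← hpyp, mul_assoc, ← hpy, ← mul_assoc, hpp],
        by rw [← hpyp, hpy, mul_assoc, hpp]⟩
    have hmem : (p * x * p : F) ∈ D := hD.mem_of_commute fun y hy => by
      obtain ⟨c, hpy, hyp⟩ := hcorner ⟨y, hy⟩
      rw [Commute, SemiconjBy, ← mul_assoc, ← mul_assoc, hyp, mul_assoc (_ * x), hpy,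
        smul_mul_assoc, smul_mul_assoc, mul_smul_comm]
    obtain ⟨c, hc, -⟩ := hcorner ⟨_, hmem⟩
    refine ⟨c, ?_⟩
    rw [← hc, ← mul_assoc, ← mul_assoc]
    exact congrArg (fun q : D => (q * x * p : F)) hp.isIdempotentElem.eq.symm

lemma IsMinimalProjection.conj_mem {e x : F} (hq : IsMinimalProjection (star e * e))
    (hp : e * star e ∈ D) : e * x * star e ∈ D := by
  have he := mul_star_mul_self_of_isStarProjection hq.toIsStarProjection
  have he' : star e * e * star e = star e := by
    simpa only [star_mul, star_star, mul_assoc] using congrArg star he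
  obtain ⟨c, hc⟩ := hq.exists_smul_eq x
  have : e * x * star e = c • (e * star e) := by
    calc e * x * star e = e * (star e * e) * x * (star e * e * star e) := by rw [he, he']
      _ = e * (star e * e * x * (star e * e)) * star e := by simp only [mul_assoc]
      _ = c • (e * star e) := by rw [hc, mul_smul_comm, he, smul_mul_assoc]
  exact this ▸ SMulMemClass.smul_mem c hp

lemma mem_normalisers_of_isMinimalProjection {e : F} (hp : IsMinimalProjection (e * star e))
    (hpD : e * star e ∈ D) (hq : IsMinimalProjection (star e * e)) (hqD : star e * e ∈ D) :
    e ∈ normalisers D := fun x _ =>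
  ⟨hq.conj_mem hpD, by
    simpa only [star_star] using IsMinimalProjection.conj_mem (e := star e) (x := x)
      (by rwa [star_star]) (by rwa [star_star])⟩

lemma IsMasa.exists_isMinimalProjection_sum_eq_one [FiniteDimensional ℂ F] (hD : IsMasa D) :
    ∃ (n : ℕ) (p : Fin n → F), (∀ k, p k ∈ D) ∧ (∀ k, IsMinimalProjection (p k)) ∧
      ∑ k, p k = 1 := by
  have : IsClosed (D : Set F) := hD.isClosed
  have : FiniteDimensional ℂ D :=
    FiniteDimensional.finiteDimensional_submodule (Subalgebra.toSubmodule D.toSubalgebra)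
  let : CommCStarAlgebra D :=
    { StarSubalgebra.cstarAlgebra D with
      mul_comm := fun x y => Subtype.ext (hD.commute x.2 y.2) }
  obtain ⟨n, p, hp, hsum⟩ := DiagonalPair.exists_isMinimalProjection_sum_eq_one D
  refine ⟨n, fun k => p k, fun k => (p k).2, fun k => hD.isMinimalProjection_coe (hp k), ?_⟩
  simpa using congrArg D.subtype hsum

end MinimalProjection

/-- A finite family of normalisers of `D` that is a (column) frame, `∑ k, e k * (e k)⋆ = 1`, and
whose coefficients `(e k)⋆ x (e l)` all lie in `D`. -/
structure IsNormaliserFrame {F ι : Type*} [Ring F] [StarRing F] [Algebra ℂ F] [StarModule ℂ F]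
    [Fintype ι] (D : StarSubalgebra ℂ F) (e : ι → F) : Prop where
  mem_normalisers : ∀ k, e k ∈ normalisers D
  sum_mul_star : ∑ k, e k * star (e k) = 1
  coeff_mem : ∀ k l x, star (e k) * x * e l ∈ D

section Frame

variable {F ι : Type*} [Ring F] [StarRing F] [Algebra ℂ F] [StarModule ℂ F] [Fintype ι]
  {D : StarSubalgebra ℂ F} {e : ι → F}

lemma IsNormaliserFrame.eq_sum (he : IsNormaliserFrame D e) (x : F) :
    x = ∑ k, ∑ l, e k * (star (e k) * x * e l) * star (e l) := by
  calc x = (∑ k, e k * star (e k)) * x * ∑ l, e l * star (e l) := by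
        rw [he.sum_mul_star, one_mul, mul_one]
    _ = ∑ k, ∑ l, e k * (star (e k) * x * e l) * star (e l) := by
        simp only [Finset.sum_mul, Finset.mul_sum, mul_assoc]
        exact Finset.sum_comm

lemma IsNormaliserFrame.span_normalisers_eq_top (he : IsNormaliserFrame D e) :
    Submodule.span ℂ (normalisers D) = ⊤ := by
  refine Submodule.eq_top_iff'.mpr fun x => he.eq_sum x ▸ ?_
  refine Submodule.sum_mem _ fun k _ => Submodule.sum_mem _ fun l _ => Submodule.subset_span ?_
  exact mul_mem_normalisers (mul_mem_normalisers (he.mem_normalisers k)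
    (mem_normalisers_of_mem (he.coeff_mem k l x))) (star_mem_normalisers (he.mem_normalisers l))

end Frame

variable {F : Type*} [CStarAlgebra F] [PartialOrder F] [StarOrderedRing F] [FiniteDimensional ℂ F]
  {D : StarSubalgebra ℂ F}

lemma IsMasa.exists_isNormaliserFrame (hD : IsMasa D) :
    ∃ (n : ℕ) (e : Fin n → F), IsNormaliserFrame D e := by
  obtain ⟨n, p, hpD, hp, hsum⟩ := hD.exists_isMinimalProjection_sum_eq_one
  let s : Setoid (Fin n) :=
    { r := fun k l => MurrayVonNeumannEquiv (p k) (p l)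
      iseqv := ⟨fun k => .refl (hp k).toIsStarProjection, .symm,
        .trans (hp _).toIsStarProjection⟩ }
  let ρ : Fin n → Fin n := fun k => (Quotient.mk s k).out
  have hρ : ∀ k, MurrayVonNeumannEquiv (p k) (p (ρ k)) := fun k =>
    s.symm (Quotient.mk_out (s := s) k)
  have hρ_eq : ∀ k l, MurrayVonNeumannEquiv (p (ρ k)) (p (ρ l)) → ρ k = ρ l := fun k l h =>
    congrArg Quotient.out (Quotient.sound (s.trans (hρ k) (s.trans h (s.symm (hρ l)))))
  choose e hep heq using hρ
  refine ⟨n, e, fun k => mem_normalisers_of_isMinimalProjection (hep k ▸ hp k) (hep k ▸ hpD k)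
    (heq k ▸ hp _) (heq k ▸ hpD _), by simp only [hep, hsum], fun k l x => ?_⟩
  have hsupport : ∀ k, e k * p (ρ k) = e k := fun k => by
    rw [← heq k]
    exact mul_star_mul_self_of_isStarProjection (heq k ▸ (hp _).toIsStarProjection)
  have hsupport_star : ∀ k, p (ρ k) * star (e k) = star (e k) := fun k => by
    simpa [(hp _).isSelfAdjoint.star_eq] using congrArg star (hsupport k)
  have hcompress : star (e k) * x * e l = p (ρ k) * (star (e k) * x * e l) * p (ρ l) := by
    rw [← mul_assoc, ← mul_assoc, hsupport_star, mul_assoc _ (e l), hsupport]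
  by_cases h0 : star (e k) * x * e l = 0
  · exact h0 ▸ zero_mem D
  · have hkl : ρ k = ρ l := hρ_eq k l ((hp _).murrayVonNeumannEquiv (hp _) (hcompress ▸ h0))
    obtain ⟨c, hc⟩ := (hp (ρ k)).exists_smul_eq (star (e k) * x * e l)
    rw [hcompress, ← hkl, hc]
    exact SMulMemClass.smul_mem c (hpD _)

end FiniteDimensional

section Positivity

variable {A : Type*} [CStarAlgebra A] [PartialOrder A] [StarOrderedRing A]
  {D : StarSubalgebra ℂ A} {Φ : A →ₗ[ℂ] D}

lemma star_mul_mul_le_norm_sq_smul {b c : A} (hc : 0 ≤ c) (h : Commute c b) :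
    star b * c * b ≤ ‖b‖ ^ 2 • c := by
  have hcs : Commute c (star b) := by simpa [(IsSelfAdjoint.of_nonneg hc).star_eq] using h.star_star
  have hb : 0 ≤ algebraMap ℝ A (‖b‖ ^ 2) - star b * b :=
    sub_nonneg.mpr CStarAlgebra.star_mul_le_algebraMap_norm_sq
  have hcomm : Commute c (algebraMap ℝ A (‖b‖ ^ 2) - star b * b) :=
    (Algebra.commute_algebraMap_right _ c).sub_right (hcs.mul_right h)
  have := hcomm.mul_nonneg hc hb
  rwa [mul_sub, sub_nonneg, ← mul_assoc, hcs.eq, ← Algebra.commutes, ← Algebra.smul_def] at this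

lemma sqrt_mem (hcl : IsClosed (D : Set A)) {x : A} (hx : x ∈ D) : CFC.sqrt x ∈ D := by
  have : IsClosed (D : Set A) := hcl
  by_cases h0 : 0 ≤ x
  · rw [CFC.sqrt_eq_real_sqrt x h0]
    exact cfcₙ_mem (𝕜' := ℂ) _ hx
  · rw [CFC.sqrt, cfcₙ_apply_of_not_predicate x h0]
    exact zero_mem D

lemma exists_coe_eq_star_mul_self (hcl : IsClosed (D : Set A)) {x : D} (h0 : 0 ≤ (x : A)) :
    ∃ s : D, x = star s * s := by
  refine ⟨⟨CFC.sqrt (x : A), sqrt_mem hcl x.2⟩, Subtype.ext ?_⟩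
  change (x : A) = star (CFC.sqrt (x : A)) * CFC.sqrt (x : A)
  rw [(IsSelfAdjoint.of_nonneg (CFC.sqrt_nonneg _)).star_eq, CFC.sqrt_mul_sqrt_self _ h0]

lemma starOrderedRing_of_isClosed (hcl : IsClosed (D : Set A)) : StarOrderedRing D :=
  .of_nonneg_iff' (fun h z => add_le_add_right (α := A) h z) fun x =>
    ⟨fun h0 => exists_coe_eq_star_mul_self hcl h0, by
      rintro ⟨s, rfl⟩
      exact star_mul_self_nonneg (s : A)⟩

lemma mem_of_nonneg_of_mem_normalisers (hcl : IsClosed (D : Set A)) {c : A} (h0 : 0 ≤ c)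
    (hc : c ∈ normalisers D) : c ∈ D := by
  have hcc : c * c ∈ D := by
    simpa only [(IsSelfAdjoint.of_nonneg h0).star_eq] using star_mul_self_mem hc
  exact CFC.sqrt_mul_self c h0 ▸ sqrt_mem hcl hcc

lemma map_mem_of_map_normalisers {F : Type*} [CStarAlgebra F] [PartialOrder F] [StarOrderedRing F]
    {E : StarSubalgebra ℂ F} (hE : IsClosed (E : Set F)) (hD : IsClosed (D : Set A)) {φ : F →CP A}
    (hφ : ∀ v ∈ normalisers E, φ v ∈ normalisers D) {x : F} (hx : x ∈ E) : φ x ∈ D := by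
  have : IsClosed (E : Set F) := hE
  let _ : CStarAlgebra E := StarSubalgebra.cstarAlgebra E
  have : StarOrderedRing E := starOrderedRing_of_isClosed hE
  lift x to E using hx
  have hspan : x ∈ Submodule.span ℂ {a : E | 0 ≤ a} := by
    rw [CStarAlgebra.span_nonneg]
    exact Submodule.mem_top
  induction hspan using Submodule.span_induction with
  | mem y hy =>
    have hy0 : 0 ≤ (y : F) := hy
    exact mem_of_nonneg_of_mem_normalisers hD (map_nonneg φ hy0) (hφ _ (mem_normalisers_of_mem y.2))
  | zero => simp
  | add y z _ _ hy hz => simpa using add_mem hy hz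
  | smul c y _ hy => simpa using SMulMemClass.smul_mem c hy

lemma IsConditionalExpectation.sum_star_mul_map_mul_nonneg (hΦ : IsConditionalExpectation D Φ)
    {ι : Type*} [Fintype ι] {M : CStarMatrix ι ι A} (hM : 0 ≤ M) (b : ι → D) :
    0 ≤ ((∑ k, ∑ l, star (b k) * Φ (M k l) * b l : D) : A) := by
  have hsum : ∑ k, ∑ l, star (b k) * Φ (M k l) * b l
      = Φ (∑ k, ∑ l, star (b k : A) * M k l * b l) := by
    simp only [map_sum]
    exact Finset.sum_congr rfl fun k _ => Finset.sum_congr rfl fun l _ =>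
      (hΦ.bimodule (star (b k)) (b l) (M k l)).symm
  exact hsum ▸ hΦ.nonneg _ (sum_star_mul_mul_nonneg hM fun k => (b k : A))

lemma IsConditionalExpectation.map_cstarMatrix_nonneg (hD : IsClosed (D : Set A))
    (hΦ : IsConditionalExpectation D Φ) {ι : Type*} [Fintype ι] {M : CStarMatrix ι ι A}
    (hM : 0 ≤ M) : 0 ≤ M.map fun a => (Φ a : A) := by
  have : IsClosed (D : Set A) := hD
  let _ : CStarAlgebra D := StarSubalgebra.cstarAlgebra D
  have : StarOrderedRing D := starOrderedRing_of_isClosed hD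
  let N : CStarMatrix ι ι D := M.map Φ
  have hN_selfAdj : IsSelfAdjoint N := CStarMatrix.ext fun k l => Subtype.ext <| by
    change star (Φ (M l k) : A) = Φ (M k l)
    rw [← hΦ.map_star, ← CStarMatrix.star_apply, (IsSelfAdjoint.of_nonneg hM).star_eq]
  have hN : 0 ≤ N := cstarMatrix_nonneg hN_selfAdj (hΦ.sum_star_mul_map_mul_nonneg hM)
  exact (D.subtype : D →CP A).map_cstarMatrix_nonneg N hN

end Positivity

section Regularisation

variable {A : Type*} [CStarAlgebra A]

lemma cfc_mul_mul_self (h : A) {f p : ℝ → ℝ} (hf : Continuous f) (hp : Continuous p) :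
    cfc (fun t => f t * p t * f t) h = cfc f h * cfc p h * cfc f h := by
  rw [cfc_mul (fun t => f t * p t) f h (hf.mul hp).continuousOn hf.continuousOn,
    cfc_mul f p h hf.continuousOn hp.continuousOn]

variable [PartialOrder A] [StarOrderedRing A]

lemma one_sub_mul_le_smul {g h c : A} (hg : g ≤ 1) (hgh : Commute g h) (hgc : Commute g c) {r : ℝ}
    (hch : c ≤ r • h) : (1 - g) * c ≤ r • ((1 - g) * h) := by
  have hcomm : Commute (1 - g) (r • h - c) :=
    (Commute.one_left _).sub_left ((hgh.smul_right r).sub_right hgc)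
  have hnonneg := hcomm.mul_nonneg (sub_nonneg.mpr hg) (sub_nonneg.mpr hch)
  rwa [mul_sub, mul_smul_comm, sub_nonneg] at hnonneg

lemma exists_regularizer {h : A} (hh : 0 ≤ h) {η : ℝ} (hη : 0 < η) :
    ∃ k : A, IsSelfAdjoint k ∧ (∀ x, Commute h x → Commute k x) ∧ k * h ^ 4 * k ≤ 1 ∧
      (1 - k * h ^ 4 * k) * h ≤ η • 1 := by
  have hmax : ∀ t, 0 < max t η := fun t => hη.trans_le (le_max_right t η)
  let f : ℝ → ℝ := fun t => (max t η ^ 2)⁻¹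
  have hf : Continuous f :=
    ((continuous_id.max continuous_const).pow 2).inv₀ fun t => (pow_pos (hmax t) 2).ne'
  have hconj : ∀ n, cfc f h * h ^ n * cfc f h = cfc (fun t => f t * t ^ n * f t) h := fun n => by
    rw [cfc_mul_mul_self h hf (continuous_pow n), cfc_pow_id h n]
  have hspec : ∀ t ∈ spectrum ℝ h, 0 ≤ t := fun t ht => spectrum_nonneg_of_nonneg hh ht
  refine ⟨cfc f h, .cfc, fun x hx => hx.cfc_real f, ?_, ?_⟩
  · rw [hconj]
    refine cfc_le_one _ _ fun t ht => ?_
    have hft : f t * t ^ 4 * f t = (t / max t η) ^ 4 := by simp only [f]; field_simp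
    exact hft ▸ pow_le_one₀ (div_nonneg (hspec t ht) (hmax t).le)
      (div_le_one_of_le₀ (le_max_left t η) (hmax t).le)
  · have hcont : Continuous fun t => f t * t ^ 5 * f t := (hf.mul (continuous_pow 5)).mul hf
    have hmul : (1 - cfc f h * h ^ 4 * cfc f h) * h = cfc (fun t => t - f t * t ^ 5 * f t) h := by
      rw [cfc_sub (fun t => t) (fun t => f t * t ^ 5 * f t) h (by fun_prop) hcont.continuousOn,
        cfc_id' ℝ h, ← hconj, sub_mul, one_mul, mul_assoc _ (cfc f h) h,
        ((Commute.refl h).cfc_real f).eq, ← mul_assoc, mul_assoc _ _ h, ← pow_succ]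
    rw [hmul, ← Algebra.algebraMap_eq_smul_one]
    refine cfc_le_algebraMap _ _ _ (fun t ht => ?_) (continuous_id.sub hcont).continuousOn
    rcases le_total t η with htη | hηt
    · have := hspec t ht
      have : 0 ≤ f t * t ^ 5 * f t := by positivity
      linarith
    · have ht0 : t ≠ 0 := (hη.trans_le hηt).ne'
      have hft : f t * t ^ 5 * f t = t := by simp only [f, max_eq_left hηt]; field_simp
      linarith

lemma exists_truncation {y : A} (hy : 0 ≤ y) {ε : ℝ} (hε : 0 < ε) :
    ∃ k : A, IsSelfAdjoint k ∧ k * (y + ε • 1) * k ≤ 2 • y ∧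
      (1 - k) * (y + ε • 1) * (1 - k) ≤ (2 * ε) • 1 := by
  let f : ℝ → ℝ := fun t => min (t / ε) 1
  have hf : Continuous f := by fun_prop
  have hadd : cfc (fun t : ℝ => t + ε) y = y + ε • 1 := by
    rw [cfc_add_const ε (fun t => t) y, cfc_id' ℝ y, Algebra.algebraMap_eq_smul_one]
  have hconj : ∀ g : ℝ → ℝ, Continuous g →
      cfc g y * (y + ε • 1) * cfc g y = cfc (fun t => g t * (t + ε) * g t) y := fun g hg => by
    rw [cfc_mul_mul_self y hg (by fun_prop), hadd]
  have hspec : ∀ t ∈ spectrum ℝ y, f t = 1 ∧ ε ≤ t ∨ ∃ u ∈ Set.Icc 0 1, f t = u ∧ t = ε * u := by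
    intro t ht
    rcases le_total ε t with h | h
    · exact .inl ⟨min_eq_right ((one_le_div hε).mpr h), h⟩
    · have hle : t / ε ≤ 1 := (div_le_one hε).mpr h
      exact .inr ⟨t / ε, ⟨div_nonneg (spectrum_nonneg_of_nonneg hy ht) hε.le, hle⟩,
        min_eq_left hle, (mul_div_cancel₀ t hε.ne').symm⟩
  refine ⟨cfc f y, .cfc, ?_, ?_⟩
  · have htwo : 2 • y = cfc (fun t : ℝ => t + t) y := by
      rw [cfc_add y (fun t => t) (fun t => t), cfc_id' ℝ y, two_nsmul]
    rw [hconj f hf, htwo, cfc_le_iff _ _ _ (by fun_prop) (by fun_prop)]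
    intro t ht
    rcases hspec t ht with ⟨hft, h⟩ | ⟨u, ⟨h0, h1⟩, hft, rfl⟩
    · rw [hft]; linarith
    · rw [hft]
      have h : 0 ≤ ε * u * (1 - u) := mul_nonneg (mul_nonneg hε.le h0) (sub_nonneg.mpr h1)
      linarith [mul_nonneg h h0]
  · have hone : 1 - cfc f y = cfc (fun t => 1 - f t) y := by
      rw [cfc_sub (fun _ => 1) f y (by fun_prop) hf.continuousOn, cfc_const_one ℝ y]
    rw [hone, hconj _ (by fun_prop), ← Algebra.algebraMap_eq_smul_one]
    refine cfc_le_algebraMap _ _ _ (fun t ht => ?_) (by fun_prop)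
    rcases hspec t ht with ⟨hft, -⟩ | ⟨u, ⟨h0, h1⟩, hft, rfl⟩
    · simp only [hft]; linarith
    · rw [hft]
      have h : 0 ≤ ε * u * (1 - u) := mul_nonneg (mul_nonneg hε.le h0) (sub_nonneg.mpr h1)
      linarith [mul_nonneg h h0, mul_nonneg hε.le h0]

variable {H : NonUnitalStarSubalgebra ℂ A}

lemma IsHereditarySubalgebra.mem_of_forall_le_add (hH : IsHereditarySubalgebra H) {a : A}
    (ha : 0 ≤ a) (h : ∀ ε : ℝ, 0 < ε → ∃ y ∈ H, 0 ≤ y ∧ a ≤ y + ε • 1) : a ∈ H := by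
  obtain ⟨s, rfl⟩ := exists_eq_star_mul_self ha
  have hclosed : IsClosed {t : A | star t * t ∈ H} :=
    hH.isClosed.preimage (continuous_star.mul continuous_id)
  refine hclosed.closure_subset (Metric.mem_closure_iff.mpr fun r hr => ?_)
  obtain ⟨y, hyH, hy0, hay⟩ := h (r ^ 2 / 4) (by positivity)
  obtain ⟨k, hk, hkH, hk1⟩ := exists_truncation hy0 (ε := r ^ 2 / 4) (by positivity)
  have hconj : ∀ b : A, IsSelfAdjoint b → star (s * b) * (s * b) ≤ b * (y + (r ^ 2 / 4) • 1) * b :=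
    fun b hb => by
      simpa only [star_mul, hb.star_eq, mul_assoc] using hb.conjugate_le_conjugate hay
  refine ⟨s * k, ?_, ?_⟩
  · exact hH.hereditary _ _ (nsmul_mem hyH 2) (star_mul_self_nonneg _)
      ((hconj k hk).trans hkH)
  · have hle := (hconj (1 - k) ((IsSelfAdjoint.one A).sub hk)).trans hk1
    rw [← Algebra.algebraMap_eq_smul_one, ← CStarAlgebra.norm_le_iff_le_algebraMap _ (by positivity)
      (star_mul_self_nonneg _), CStarRing.norm_star_mul_self] at hle
    rw [dist_eq_norm, ← mul_one_sub]
    nlinarith [norm_nonneg (s * (1 - k))]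

end Regularisation

section Compression

variable {A : Type*} [CStarAlgebra A] {D : StarSubalgebra ℂ A} {Φ : A →ₗ[ℂ] D}
  {ι : Type*} [Fintype ι]

/-- The compression `y ↦ ∑ k, ∑ l, v k Φ(v k⋆ y v l) v l⋆` of `y` by a finite family `v`. For a
suitable family of normalisers it reproduces the range of an order zero map up to a factor in `D`
while being dominated by multiples of `Φ`. -/
noncomputable def compression (Φ : A →ₗ[ℂ] D) (v : ι → A) : A →ₗ[ℂ] A :=
  ∑ k, ∑ l, LinearMap.mulLeftRight ℂ (v k, star (v l)) ∘ₗ D.subtype.toLinearMap ∘ₗ Φ ∘ₗ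
    LinearMap.mulLeftRight ℂ (star (v k), v l)

lemma compression_apply (Φ : A →ₗ[ℂ] D) (v : ι → A) (y : A) :
    compression Φ v y = ∑ k, ∑ l, v k * Φ (star (v k) * y * v l) * star (v l) := by
  simp [compression]

variable [PartialOrder A] [StarOrderedRing A]

lemma compression_nonneg (hD : IsClosed (D : Set A)) (hΦ : IsConditionalExpectation D Φ)
    (v : ι → A) {y : A} (hy : 0 ≤ y) : 0 ≤ compression Φ v y := by
  simpa [compression_apply, conjMatrix_apply] using
    sum_star_mul_mul_nonneg (hΦ.map_cstarMatrix_nonneg hD (conjMatrix_nonneg hy v))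
      fun k => star (v k)

lemma compression_mono (hD : IsClosed (D : Set A)) (hΦ : IsConditionalExpectation D Φ)
    (v : ι → A) {y z : A} (hyz : y ≤ z) : compression Φ v y ≤ compression Φ v z := by
  rw [← sub_nonneg, ← map_sub]
  exact compression_nonneg hD hΦ v (sub_nonneg.mpr hyz)

lemma IsConditionalExpectation.normaliser_mul_map_conj_mul_star_le (hD : IsMasa D)
    (hΦ : IsConditionalExpectation D Φ)
    (hspan : (Submodule.span ℂ (normalisers D)).topologicalClosure = ⊤)
    {v a : A} (hv : v ∈ normalisers D) (ha : 0 ≤ a) :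
    v * Φ (star v * a * v) * star v ≤ ‖v‖ ^ 4 • (Φ a : A) := by
  have hcomm : Commute (Φ a : A) (v * star v) := hD.commute (Φ a).2 (mul_star_self_mem hv)
  calc v * Φ (star v * a * v) * star v
      = star (v * star v) * Φ a * (v * star v) := by
        rw [hΦ.normaliser_mul_map_conj_mul_star hD hspan hv, sq, ← hcomm.right_comm, star_mul,
          star_star]
    _ ≤ ‖v * star v‖ ^ 2 • (Φ a : A) := star_mul_mul_le_norm_sq_smul (hΦ.nonneg a ha) hcomm
    _ = ‖v‖ ^ 4 • (Φ a : A) := by rw [CStarRing.norm_self_mul_star, ← sq, ← pow_mul]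

lemma compression_le (hD : IsMasa D) (hΦ : IsConditionalExpectation D Φ)
    (hspan : (Submodule.span ℂ (normalisers D)).topologicalClosure = ⊤)
    {v : ι → A} (hv : ∀ k, v k ∈ normalisers D) {a : A} (ha : 0 ≤ a) :
    compression Φ v a ≤ (Fintype.card ι * ∑ k, ‖v k‖ ^ 4) • (Φ a : A) := by
  have hM := hΦ.map_cstarMatrix_nonneg hD.isClosed (conjMatrix_nonneg ha v)
  calc compression Φ v a
      ≤ (Fintype.card ι : ℝ) • ∑ k, v k * Φ (star (v k) * a * v k) * star (v k) := by
        simpa [compression_apply, conjMatrix_apply] using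
          sum_star_mul_mul_le_diag hM fun k => star (v k)
    _ ≤ (Fintype.card ι : ℝ) • ∑ k, ‖v k‖ ^ 4 • (Φ a : A) := by
        gcongr with k
        exact hΦ.normaliser_mul_map_conj_mul_star_le hD hspan (hv k) ha
    _ = (Fintype.card ι * ∑ k, ‖v k‖ ^ 4) • (Φ a : A) := by rw [← Finset.sum_smul, smul_smul]

end Compression

section OrderZeroCompression

variable {F A : Type*} [CStarAlgebra F] [PartialOrder F] [StarOrderedRing F]
  [CStarAlgebra A] [PartialOrder A] [StarOrderedRing A]
  {E : StarSubalgebra ℂ F} {D : StarSubalgebra ℂ A} {Φ : A →ₗ[ℂ] D} {φ : F →CP A}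

lemma map_le_norm_smul_map_one (φ : F →CP A) {x : F} (hx : 0 ≤ x) : φ x ≤ ‖x‖ • φ 1 := by
  have hle := OrderHomClass.mono φ (IsSelfAdjoint.of_nonneg hx).le_algebraMap_norm_self
  rwa [Algebra.algebraMap_eq_smul_one, ← Complex.coe_smul, map_smul, Complex.coe_smul] at hle

variable [FiniteDimensional ℂ F]

lemma IsOrderZero.map_mul_map_mul_map (hφ : IsOrderZero φ.toLinearMap) (x y z : F) :
    φ x * φ y * φ z = φ 1 ^ 2 * φ (x * y * z) := by
  rw [hφ.map_mul_map, mul_assoc, hφ.commute_map_one z, ← mul_assoc, hφ.map_mul_map,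
    mul_assoc, ← sq, ((hφ.commute_map_one _).pow_left 2).eq]

lemma IsOrderZero.compression_eq (hE : IsMasa E) (hD : IsMasa D)
    (hΦ : IsConditionalExpectation D Φ) (hφ : IsOrderZero φ.toLinearMap)
    (hφn : ∀ v ∈ normalisers E, φ v ∈ normalisers D) {ι : Type*} [Fintype ι] {e : ι → F}
    (he : IsNormaliserFrame E e) {n : ℕ} {x : F} {y : A}
    (hy : ∀ k l, star (φ (e k)) * y * φ (e l) = φ 1 ^ n * φ (star (e k) * x * e l)) :
    compression Φ (fun k => φ (e k)) y = φ 1 ^ (n + 2) * φ x := by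
  have hmem : ∀ {z}, z ∈ E → φ z ∈ D := map_mem_of_map_normalisers hE.isClosed hD.isClosed hφn
  have hterm : ∀ k l, φ (e k) * Φ (star (φ (e k)) * y * φ (e l)) * star (φ (e l))
      = φ 1 ^ (n + 2) * φ (e k * (star (e k) * x * e l) * star (e l)) := fun k l => by
    rw [hy, hΦ.map_of_mem (mul_mem (pow_mem (hmem (one_mem E)) n) (hmem (he.coeff_mem k l x))),
      ← mul_assoc, ← ((hφ.commute_map_one (e k)).pow_left n).eq, ← map_star, mul_assoc, mul_assoc,
      ← mul_assoc (φ (e k)), hφ.map_mul_map_mul_map, ← mul_assoc, ← pow_add]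
  simp only [compression_apply, hterm, ← Finset.mul_sum, ← map_sum, ← he.eq_sum x]

lemma IsOrderZero.exists_pow_mul_map_le (hE : IsMasa E) (hD : IsMasa D)
    (hΦ : IsConditionalExpectation D Φ)
    (hspan : (Submodule.span ℂ (normalisers D)).topologicalClosure = ⊤)
    (hφ : IsOrderZero φ.toLinearMap) (hφn : ∀ v ∈ normalisers E, φ v ∈ normalisers D)
    {x : F} {a : A} (ha : 0 ≤ a) {δ : ℝ} (hxa : φ x ≤ a + δ • 1) :
    ∃ C : ℝ, 0 ≤ C ∧ φ 1 ^ 4 * φ x ≤ C • (Φ a : A) + δ • φ 1 ^ 4 := by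
  obtain ⟨n, e, he⟩ := hE.exists_isNormaliserFrame
  set v : Fin n → A := fun k => φ (e k)
  have hx : compression Φ v (φ x) = φ 1 ^ 4 * φ x :=
    hφ.compression_eq hE hD hΦ hφn he fun k l => by rw [← map_star, hφ.map_mul_map_mul_map]
  have hone : compression Φ v 1 = φ 1 ^ 4 :=
    (hφ.compression_eq hE hD hΦ hφn he (n := 1) (x := 1) fun k l => by
      rw [mul_one, mul_one, ← map_star, hφ.map_mul_map, pow_one,
        (hφ.commute_map_one _).eq]).trans (pow_succ _ 3).symm
  refine ⟨Fintype.card (Fin n) * ∑ k, ‖v k‖ ^ 4, by positivity, ?_⟩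
  calc φ 1 ^ 4 * φ x = compression Φ v (φ x) := hx.symm
    _ ≤ compression Φ v (a + δ • 1) := compression_mono hD.isClosed hΦ v hxa
    _ = compression Φ v a + δ • φ 1 ^ 4 := by
        rw [map_add, LinearMap.map_smul_of_tower, hone]
    _ ≤ _ := by
        gcongr
        exact compression_le hD hΦ hspan (fun k => hφn _ (he.mem_normalisers k)) ha

lemma IsOrderZero.exists_map_le (hE : IsMasa E) (hD : IsMasa D) (hΦ : IsConditionalExpectation D Φ)
    (hspan : (Submodule.span ℂ (normalisers D)).topologicalClosure = ⊤)
    (hφ : IsOrderZero φ.toLinearMap) (hφn : ∀ v ∈ normalisers E, φ v ∈ normalisers D)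
    {x : F} (hx : 0 ≤ x) {a : A} (ha : 0 ≤ a) {δ ε : ℝ} (hδ : 0 ≤ δ) (hε : 0 < ε)
    (hxa : φ x ≤ a + δ • 1) : ∃ C : ℝ, 0 ≤ C ∧ φ x ≤ C • (Φ a : A) + (δ + ε) • 1 := by
  obtain ⟨C, hC0, hC⟩ := hφ.exists_pow_mul_map_le hE hD hΦ hspan hφn ha hxa
  obtain ⟨k, hk, hkcomm, hk1, hkh⟩ := exists_regularizer (map_nonneg φ (zero_le_one' F))
    (η := ε / (‖x‖ + 1)) (by positivity)
  set g := k * φ 1 ^ 4 * k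
  have honeD : φ 1 ∈ D := map_mem_of_map_normalisers hE.isClosed hD.isClosed hφn (one_mem E)
  have hkΦ : Commute k (Φ a : A) := hkcomm _ (hD.commute honeD (Φ a).2)
  have hkx : Commute k (φ x) := hkcomm _ (hφ.commute_map_one x)
  have hgx : Commute g (φ x) := (hkx.mul_left ((hφ.commute_map_one x).pow_left 4)).mul_left hkx
  have hg1 : Commute g (φ 1) :=
    ((hkcomm _ (.refl _)).mul_left ((Commute.refl _).pow_left 4)).mul_left (hkcomm _ (.refl _))
  have hcut : g * φ x ≤ (C * ‖k‖ ^ 2) • (Φ a : A) + δ • 1 :=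
    calc g * φ x = k * (φ 1 ^ 4 * φ x) * k := by simp only [g, mul_assoc, hkx.eq]
      _ ≤ k * (C • (Φ a : A) + δ • φ 1 ^ 4) * k := hk.conjugate_le_conjugate hC
      _ = C • (star k * Φ a * k) + δ • g := by simp [g, hk.star_eq, mul_add, add_mul]
      _ ≤ C • ‖k‖ ^ 2 • (Φ a : A) + δ • 1 := by
          gcongr
          exact star_mul_mul_le_norm_sq_smul (hΦ.nonneg a ha) hkΦ.symm
      _ = (C * ‖k‖ ^ 2) • (Φ a : A) + δ • 1 := by rw [smul_smul]
  have hrest : (1 - g) * φ x ≤ ε • 1 :=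
    calc (1 - g) * φ x ≤ ‖x‖ • ((1 - g) * φ 1) :=
          one_sub_mul_le_smul hk1 hg1 hgx (map_le_norm_smul_map_one φ hx)
      _ ≤ ‖x‖ • (ε / (‖x‖ + 1)) • 1 := by gcongr
      _ ≤ ε • 1 := by
          rw [smul_smul]
          refine smul_le_smul_of_nonneg_right ?_ zero_le_one
          rw [mul_div_left_comm]
          exact mul_le_of_le_one_right hε.le (div_le_one_of_le₀ (by linarith) (by positivity))
  refine ⟨C * ‖k‖ ^ 2, by positivity, ?_⟩
  calc φ x = g * φ x + (1 - g) * φ x := by rw [← add_mul, add_sub_cancel, one_mul]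
    _ ≤ (C * ‖k‖ ^ 2) • (Φ a : A) + δ • 1 + ε • 1 := add_le_add hcut hrest
    _ = _ := by rw [add_assoc, ← add_smul]

end OrderZeroCompression

section DiagonalDimension

variable {A : Type*} [CStarAlgebra A] [PartialOrder A] [StarOrderedRing A]

/-- The restriction of a completely positive map to a summand of a direct sum. -/
noncomputable def cpSingle {ι : Type*} [Fintype ι] [DecidableEq ι] {F : ι → Type*}
    [∀ i, CStarAlgebra (F i)] [∀ i, PartialOrder (F i)] [∀ i, StarOrderedRing (F i)]
    (φ : ((i : ι) → F i) →CP A) (i : ι) : F i →CP A where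
  toLinearMap := φ.toLinearMap ∘ₗ LinearMap.single ℂ F i
  map_cstarMatrix_nonneg' k M hM := by
    obtain ⟨S, rfl⟩ := exists_eq_star_mul_self hM
    let T : CStarMatrix (Fin k) (Fin k) ((i : ι) → F i) := S.map (Pi.single i)
    have hT : 0 ≤ (star T * T).map φ := φ.map_cstarMatrix_nonneg _ (star_mul_self_nonneg T)
    refine hT.trans_eq (CStarMatrix.ext fun a b => congrArg φ ?_)
    rw [CStarMatrix.mul_apply, CStarMatrix.mul_apply, map_sum]
    refine Finset.sum_congr rfl fun m _ => ?_
    change star (Pi.single i (S m a)) * Pi.single i (S m b) = Pi.single i (star (S m a) * S m b)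
    rw [Pi.single_mul, Pi.single_star]

lemma cpSingle_apply {ι : Type*} [Fintype ι] [DecidableEq ι] {F : ι → Type*}
    [∀ i, CStarAlgebra (F i)] [∀ i, PartialOrder (F i)] [∀ i, StarOrderedRing (F i)]
    (φ : ((i : ι) → F i) →CP A) (i : ι) (x : F i) : cpSingle φ i x = φ (Pi.single i x) := rfl

lemma sum_cpSingle_apply {ι : Type*} [Fintype ι] [DecidableEq ι] {F : ι → Type*}
    [∀ i, CStarAlgebra (F i)] [∀ i, PartialOrder (F i)] [∀ i, StarOrderedRing (F i)]
    (φ : ((i : ι) → F i) →CP A) (x : (i : ι) → F i) : ∑ i, cpSingle φ i (x i) = φ x := by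
  simp only [cpSingle_apply, ← map_sum, Finset.univ_sum_single]

variable {D : StarSubalgebra ℂ A} {Φ : A →ₗ[ℂ] D} {d : ℕ}

lemma DiagDimLE.topologicalClosure_span_normalisers (hd : DiagDimLE D d) :
    (Submodule.span ℂ (normalisers D)).topologicalClosure = ⊤ := by
  refine eq_top_iff.mpr fun a _ => Metric.mem_closure_iff.mpr fun ε hε => ?_
  obtain ⟨F, ψ, φ, -, happ, -, -, -, hφn⟩ := hd {a} ε hε
  refine ⟨φ (ψ a), ?_, ?_⟩
  · rw [← sum_cpSingle_apply]
    refine sum_mem fun i _ => ?_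
    have hspan : ψ a i ∈ Submodule.span ℂ (normalisers (F i).masa) := by
      obtain ⟨n, e, he⟩ := (F i).isMasa.exists_isNormaliserFrame
      exact he.span_normalisers_eq_top ▸ Submodule.mem_top
    have hle : Submodule.span ℂ (normalisers (F i).masa)
        ≤ (Submodule.span ℂ (normalisers D)).comap (cpSingle φ i).toLinearMap :=
      Submodule.span_le.mpr fun v hv => Submodule.subset_span (hφn i v hv)
    exact hle hspan
  · rw [dist_comm, dist_eq_norm]
    exact happ a (Finset.mem_singleton_self a)

lemma le_add_smul_one_of_norm_sub_le {a b : A} (ha : IsSelfAdjoint a) (hb : IsSelfAdjoint b) {r : ℝ}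
    (h : ‖a - b‖ ≤ r) : a ≤ b + r • 1 := by
  rw [← sub_le_iff_le_add', ← Algebra.algebraMap_eq_smul_one]
  exact (ha.sub hb).le_algebraMap_norm_self.trans (algebraMap_mono A h)

lemma DiagDimLE.exists_le_smul_add (hd : DiagDimLE D d) (hD : IsMasa D)
    (hΦ : IsConditionalExpectation D Φ) {a : A} (ha : 0 ≤ a) {ε : ℝ} (hε : 0 < ε) :
    ∃ C : ℝ, 0 ≤ C ∧ a ≤ C • (Φ a : A) + ε • 1 := by
  set δ : ℝ := ε / (2 * (d + 1) + 1) with hδ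
  have hδ0 : 0 < δ := by positivity
  obtain ⟨F, ψ, φ, -, happ, -, -, hφ, hφn⟩ := hd {a} δ hδ0
  have hψ : 0 ≤ ψ a := map_nonneg ψ ha
  have hsa : IsSelfAdjoint (φ (ψ a)) := .of_nonneg (map_nonneg φ hψ)
  have hnorm : ‖φ (ψ a) - a‖ ≤ δ := (happ a (Finset.mem_singleton_self a)).le
  have hupper : φ (ψ a) ≤ a + δ • 1 := le_add_smul_one_of_norm_sub_le hsa (.of_nonneg ha) hnorm
  have hlower : a ≤ φ (ψ a) + δ • 1 :=
    le_add_smul_one_of_norm_sub_le (.of_nonneg ha) hsa (norm_sub_rev a _ ▸ hnorm)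
  have hsummand : ∀ i, ∃ C : ℝ,
      0 ≤ C ∧ cpSingle φ i (ψ a i) ≤ C • (Φ a : A) + (δ + δ) • 1 := fun i => by
    refine IsOrderZero.exists_map_le (F i).isMasa hD hΦ hd.topologicalClosure_span_normalisers
      (hφ i) (hφn i) (hψ i) ha hδ0.le hδ0 (le_trans ?_ hupper)
    rw [← sum_cpSingle_apply φ (ψ a)]
    exact Finset.single_le_sum (fun j _ => map_nonneg (cpSingle φ j) (hψ j)) (Finset.mem_univ i)
  choose C hC0 hC using hsummand
  refine ⟨∑ i, C i, Finset.sum_nonneg fun i _ => hC0 i, ?_⟩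
  calc a ≤ ∑ i, cpSingle φ i (ψ a i) + δ • 1 := by rwa [sum_cpSingle_apply]
    _ ≤ ∑ i, (C i • (Φ a : A) + (δ + δ) • 1) + δ • 1 := by
        gcongr with i
        exact hC i
    _ = (∑ i, C i) • (Φ a : A) + ε • 1 := by
        rw [Finset.sum_add_distrib, ← Finset.sum_smul, Finset.sum_const, Finset.card_univ,
          Fintype.card_fin, add_assoc, ← Nat.cast_smul_eq_nsmul ℝ, smul_smul, ← add_smul, hδ]
        congr 2
        push_cast
        field_simp
        ring

theorem isHereditaryMap_of_diagDimLE (hD : IsMasa D) (hΦ : IsConditionalExpectation D Φ)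
    (hd : DiagDimLE D d) : IsHereditaryMap D Φ := by
  intro a ha
  simp only [her, NonUnitalStarAlgebra.mem_sInf, Set.mem_ofPred_eq]
  rintro H ⟨hH, haH⟩
  refine hH.mem_of_forall_le_add ha fun ε hε => ?_
  obtain ⟨C, hC0, hC⟩ := hd.exists_le_smul_add hD hΦ ha hε
  refine ⟨C • (Φ a : A), ?_, smul_nonneg hC0 (hΦ.nonneg a ha), hC⟩
  exact Complex.coe_smul C (Φ a : A) ▸ SMulMemClass.smul_mem (C : ℂ) haH

end DiagonalDimension

end DiagonalPair

theorem propositionD_general {A : Type*} [CStarAlgebra A] [PartialOrder A] [StarOrderedRing A]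
    (D : StarSubalgebra ℂ A) (hD : DiagonalPair.IsMasa D)
    (Φ : A →ₗ[ℂ] D) (hΦ : DiagonalPair.IsConditionalExpectation D Φ)
    (hdim : DiagonalPair.diagDim D < ⊤) :
    DiagonalPair.IsHereditaryMap D Φ := by
  obtain ⟨d, hd⟩ : ∃ d, DiagonalPair.DiagDimLE D d := by
    by_contra! h
    simp [DiagonalPair.diagDim, h] at hdim
  exact DiagonalPair.isHereditaryMap_of_diagDimLE hD hΦ hd

theorem propositionD {A : Type*} [CStarAlgebra A] [PartialOrder A] [StarOrderedRing A]
    (D : StarSubalgebra ℂ A) (hD : DiagonalPair.IsDiagonalPair D)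
    (Φ : A →ₗ[ℂ] D) (hΦ : DiagonalPair.IsAssociatedExpectation D Φ)
    (hdim : DiagonalPair.diagDim D < ⊤) :
    DiagonalPair.IsHereditaryMap D Φ :=
  propositionD_general D hD.masa Φ hΦ.toIsConditionalExpectation hdim
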